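/- A platform has $L$ drivers; riders arrive at rate $\Lambda>0$. A state $(l,m)\in\mathcal S=\{0,\dots,L\}\times\mathbb Z_{\ge 0}$ records the number $l$ of drivers in service and the number $m$ of riders in the queue. A policy $(\lambda,\phi)$ consists of effective request rates $\lambda:\mathcal S\to[0,\Lambda]$ and a dispatching rule $\phi:\mathcal S\to\{0,1\}$ with $\phi(l,0)=0$ and $\phi(L,m)=0$. In state $(l,m)$ riders join the queue at rate $\lambda(l,m)$, and each driver in service completes his ride at rate $\mu_{l,m}>0$, where $\mu$ is bounded; after each such event the state moves instantaneously from $(l,m)$ to $(l+1,m-1)$ as long as $\phi(l,m)=1$. The service time of a ride consists of a pick-up time followed by an on-trip time. On-trip times are identically distributed with mean $t_0\in(0,\infty)$, and the on-trip time of a ride is independent of its request time, of the state the rider found on requesting, and of its dispatch time. A rider who requests in state $(l,m)$ pays $p_0+p_1(\lambda(l,m))\,d$, where the trip distance $d$ equals the on-trip time (unit speed), $p_0\ge 0$ is the base fare, and $p_1(\lambda)\in[0,p_{\max}]$ is the price with $\Lambda(1-F(p_1(\lambda)))=\lambda$; here $F$ is the distribution function of the riders' willingness to pay, and $1-F$ decreases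 strictly and bijectively from $1$ at $0$ to $0$ at $p_{\max}$. A policy is called stable if its Markov chain on $\mathcal S$ has a stationary distribution $\pi_{\lambda,\phi}$ (unique if the chain is a unichain; otherwise fix one for each stable policy), and each stable policy is operated in steady state. Let $\mathcal R(\lambda,\phi;p_0)$ be the long-run average revenue rate with base fare $p_0$, let $L_s^d$, $L_o^d=L-L_s^d$ and $L_q^r\in[0,\infty]$ be the stationary expected numbers of drivers in service, of idle drivers and of riders in the queue, and let $L_p^r$ be the long-run average expected number of riders waiting to be picked up by a driver already dispatched. Let $w_s^d,w_o^d,w_p^r,w_q^r>0$. Then, for every stable policy, the limits defining $\mathcal R(\lambda,\phi;p_0)$, $\mathcal R(\lambda,\phi;p_0+w_p^r t_0)$ and $L_p^r(\lambda,\phi)$ exist and are finite, and $$\operatorname*{argmax}_{\lambda,\phi}\Big(\mathcal R(\lambda,\phi;p_0)-w_s^dL_s^d(\lambda,\phi)-w_o^dL_o^d(\lambda,\phi)-w_p^rL_p^r(\lambda,\phi)-w_q^rL_q^r(\lambda,\phi)\Big)$$ $$=\operatorname*{argmax}_{\lambda,\phi}\Big(\mathcal R(\lambda,\phi;p_0+w_p^rt_0)-(w_s^d+w_p^r-w_o^d)L_s^d(\lambda,\phi)-w_q^rL_q^r(\lambda,\phi)\Big),$$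 as sets of stable policies, where an objective with $L_q^r(\lambda,\phi)=\infty$ has the value $-\infty$. -/

import Mathlib

open MeasureTheory ProbabilityTheory Filter Topology
open scoped ENNReal NNReal

noncomputable section

namespace RideHailing

/-- Primitives of the platform model. -/
structure Model where
  /-- fleet size `L` -/
  L : ℕ
  /-- total arrival rate `Λ` of riders -/
  Lam : ℝ
  Lam_pos : 0 < Lam
  /-- law of a rider's willingness to pay per kilometre; `F` is its CDF -/
  wtp : Measure ℝ
  wtp_prob : IsProbabilityMeasure wtp
  /-- largest per-kilometre price -/
  pmax : ℝ
  pmax_pos : 0 < pmax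
  /-- the tail CDF `1 - F` decreases strictly from `1` to `0` on `[0, pmax]`, and prices in
  `[0, pmax]` and conversion probabilities in `[0, 1]` correspond one to one -/
  tail_zero : 1 - cdf wtp 0 = 1
  tail_pmax : 1 - cdf wtp pmax = 0
  tail_strictAnti : StrictAntiOn (fun p => 1 - cdf wtp p) (Set.Icc 0 pmax)
  tail_bijOn : Set.BijOn (fun p => 1 - cdf wtp p) (Set.Icc 0 pmax) (Set.Icc 0 1)
  /-- `mu l m`: service rate of each driver in service, with `l` drivers in service and `m` riders
  in the queue -/
  mu : ℕ → ℕ → ℝ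
  mu_pos : ∀ l m, l ≤ L → 0 < mu l m
  mu_bdd : ∃ b : ℝ, 0 < b ∧ ∀ l m, l ≤ L → mu l m ≤ b
  /-- law of the on-trip time of a ride; as vehicles drive at speed `1`, it is also the law of the
  trip distance -/
  tripLaw : Measure ℝ≥0
  tripLaw_prob : IsProbabilityMeasure tripLaw
  /-- the mean on-trip time -/
  t0 : ℝ
  t0_pos : 0 < t0
  tripLaw_mean : ∫⁻ y, (y : ℝ≥0∞) ∂tripLaw = ENNReal.ofReal t0

namespace Model

variable (M : Model)

/-- States `(l, m)`: `l` drivers in service, `m` riders waiting in the queue. -/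
abbrev State : Type := Fin (M.L + 1) × ℕ

/-- `p₁(λ)`: the per-kilometre price in `[0, pmax]` at which the effective request rate
`Λ (1 - F(p))` equals `lam`. -/
def price (lam : ℝ) : ℝ :=
  Function.invFunOn (fun p => M.Lam * (1 - cdf M.wtp p)) (Set.Icc 0 M.pmax) lam

/-- A pricing policy, given by the effective request rates, and a dispatching policy. -/
structure Policy where
  rate : M.State → ℝ
  rate_mem : ∀ x, rate x ∈ Set.Icc 0 M.Lam
  dispatch : M.State → Bool
  /-- no dispatch without a rider in the queue -/
  dispatch_empty : ∀ l, dispatch (l, 0) = false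
  /-- no dispatch without an idle driver -/
  dispatch_full : ∀ m, dispatch (Fin.last M.L, m) = false

variable {M}

/-- The state reached from `(l, m)` after the instantaneous dispatches: move from `(l, m)` to
`(l + 1, m - 1)` as long as the policy says dispatch. -/
def settle (φ : M.State → Bool) : Fin (M.L + 1) → ℕ → M.State
  | l, 0 => (l, 0)
  | l, m + 1 =>
    if h : φ (l, m + 1) = true ∧ l.val < M.L then
      settle φ ⟨l.val + 1, Nat.succ_lt_succ h.2⟩ m
    else (l, m + 1)

/-- The state right after a rider has joined the queue in state `x`. -/
def Policy.afterRequest (p : M.Policy) (x : M.State) : M.State :=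
  settle p.dispatch x.1 (x.2 + 1)

/-- The state right after a trip completion in state `x`. -/
def Policy.afterCompletion (p : M.Policy) (x : M.State) : M.State :=
  settle p.dispatch ⟨x.1.val - 1, lt_of_le_of_lt (Nat.sub_le _ _) x.1.isLt⟩ x.2

/-- Total trip completion rate `l μ_{l,m}`. -/
def completionRate (x : M.State) : ℝ := (x.1.val : ℝ) * M.mu x.1.val x.2

open Classical in
/-- Transition rate from `x` to `y`. -/
def Policy.transitionRate (p : M.Policy) (x y : M.State) : ℝ≥0∞ :=
  (if p.afterRequest x = y then ENNReal.ofReal (p.rate x) else 0) +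
  (if p.afterCompletion x = y then ENNReal.ofReal (completionRate x) else 0)

/-- `π` is a stationary distribution of the chain of the policy: it gives no mass to states in
which the system never remains, and it satisfies the global balance equations. -/
def Policy.IsStationary (p : M.Policy) (π : PMF M.State) : Prop :=
  (∀ x, p.dispatch x = true → π x = 0) ∧
  ∀ y, ∑' x, π x * p.transitionRate x y = π y * ∑' z, p.transitionRate y z

/-- The queue is stable: a stationary distribution exists. -/
def Policy.IsStable (p : M.Policy) : Prop := ∃ π : PMF M.State, p.IsStationary π

variable (M) in
/-- Policies under which the queue is stable. -/
abbrev StablePolicy : Type := {p : M.Policy // p.IsStable}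

end Model

/-- The point process with points `τ i` in `(0, ∞)` (a value `∞` means no point) has stochastic
intensity `ρ` with respect to the filtration `F`: for every nonnegative predictable process `H`,
`E ∑ᵢ H(τ i) = E ∫ H(t) ρ(t) dt`. -/
def HasIntensity {Ω ι : Type*} {mΩ : MeasurableSpace Ω} (P : Measure Ω)
    (F : Filtration ℝ≥0 mΩ) (τ : ι → Ω → ℝ≥0∞) (ρ : ℝ≥0 → Ω → ℝ≥0∞) : Prop :=
  ∀ H : ℝ≥0 × Ω → ℝ≥0∞, Measurable[F.predictable] H →
    ∫⁻ ω, ∑' i, Set.indicator (Set.Ioo 0 ⊤) (fun s => H (s.toNNReal, ω)) (τ i ω) ∂P =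
      ∫⁻ ω, (∫⁻ t in Set.Ioi (0 : ℝ), H (t.toNNReal, ω) * ρ t.toNNReal ω) ∂P

/-- The random times attached to the rides. Ride `n` is requested (and the rider joins the
queue) at `request n`, a driver is dispatched at `dispatch n`, picks the rider up at `pickup n`,
and then drives for the time `trip n`. A time `∞` means that the event never takes place.
Rides are labelled in an arbitrary way. Rides that are in the system at time `0` are requested at
time `0`, and those in service at time `0` start their service at time `0` (service being
memoryless, this does not affect the evolution of the state). -/
structure Rides (Ω : Type*) where
  request : ℕ → Ω → ℝ≥0∞
  dispatch : ℕ → Ω → ℝ≥0∞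
  pickup : ℕ → Ω → ℝ≥0∞
  trip : ℕ → Ω → ℝ≥0

namespace Rides

variable {Ω : Type*} (R : Rides Ω)

/-- The time at which ride `n` is completed. -/
def completion (n : ℕ) (ω : Ω) : ℝ≥0∞ := R.pickup n ω + R.trip n ω

/-- Number of drivers in service at time `t`. -/
def numInService (t : ℝ≥0) (ω : Ω) : ℕ :=
  {n | R.dispatch n ω ≤ t ∧ t < R.completion n ω}.ncard

/-- Number of riders in the queue at time `t`. -/
def numInQueue (t : ℝ≥0) (ω : Ω) : ℕ :=
  {n | R.request n ω ≤ t ∧ t < R.dispatch n ω}.ncard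

/-- Number of riders waiting to be picked up at time `t` by a driver already dispatched. -/
def numInPickup (t : ℝ≥0) (ω : Ω) : ℕ :=
  {n | R.dispatch n ω ≤ t ∧ t < R.pickup n ω}.ncard

/-- Number of drivers in service just before time `t`. -/
def numInServiceBefore (t : ℝ≥0) (ω : Ω) : ℕ :=
  {n | R.dispatch n ω < t ∧ t ≤ R.completion n ω}.ncard

/-- Number of riders in the queue just before time `t`. -/
def numInQueueBefore (t : ℝ≥0) (ω : Ω) : ℕ :=
  {n | R.request n ω < t ∧ t ≤ R.dispatch n ω}.ncard

/-- The state at time `t` (the number of drivers in service is truncated at `L` only to land in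
the state space). -/
def stateAt (M : Model) (t : ℝ≥0) (ω : Ω) : M.State :=
  (⟨min (R.numInService t ω) M.L, Nat.lt_succ_of_le (min_le_right _ _)⟩, R.numInQueue t ω)

/-- The state just before time `t`. -/
def stateBefore (M : Model) (t : ℝ≥0) (ω : Ω) : M.State :=
  (⟨min (R.numInServiceBefore t ω) M.L, Nat.lt_succ_of_le (min_le_right _ _)⟩,
    R.numInQueueBefore t ω)

end Rides

open Model

/-- The system operated under the policy `p` in steady state, on some probability space. -/
structure SteadyState (M : Model) (p : M.Policy) where
  /-- the stationary distribution -/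
  π : PMF M.State
  isStationary : p.IsStationary π
  Ω : Type
  mΩ : MeasurableSpace Ω
  P : Measure Ω
  prob : IsProbabilityMeasure P
  /-- the history (it need not reveal whether a rider has been picked up yet) -/
  F : Filtration ℝ≥0 mΩ
  rides : Rides Ω
  /-- requests, dispatches and completions are observed when they take place -/
  request_adapted : ∀ n t, MeasurableSet[F t] {ω | rides.request n ω ≤ t}
  dispatch_adapted : ∀ n t, MeasurableSet[F t] {ω | rides.dispatch n ω ≤ t}
  completion_adapted : ∀ n t, MeasurableSet[F t] {ω | rides.completion n ω ≤ t}
  measurable_pickup : ∀ n, Measurable (rides.pickup n)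
  measurable_trip : ∀ n, Measurable (rides.trip n)
  /-- chronological order of the phases of a ride; a ride is not over at time `0` -/
  request_le_dispatch : ∀ᵐ ω ∂P, ∀ n, rides.request n ω ≤ rides.dispatch n ω
  dispatch_le_pickup : ∀ᵐ ω ∂P, ∀ n, rides.dispatch n ω ≤ rides.pickup n ω
  completion_pos : ∀ᵐ ω ∂P, ∀ n, 0 < rides.completion n ω
  /-- finitely many requests in finite time -/
  locallyFinite : ∀ᵐ ω ∂P, ∀ t : ℝ≥0, {n | rides.request n ω ≤ t}.Finite
  /-- there are `L` drivers -/
  capacity : ∀ᵐ ω ∂P, ∀ t : ℝ≥0, rides.numInService t ω ≤ M.L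
  /-- at each positive time there is at most one request or completion -/
  simple : ∀ᵐ ω ∂P, ∀ t : ℝ≥0, 0 < t →
    {n | rides.request n ω = t}.encard + {n | rides.completion n ω = t}.encard ≤ 1
  /-- drivers are dispatched as the policy prescribes -/
  step_request : ∀ᵐ ω ∂P, ∀ t : ℝ≥0, 0 < t → (∃ n, rides.request n ω = t) →
    rides.stateAt M t ω = p.afterRequest (rides.stateBefore M t ω)
  step_completion : ∀ᵐ ω ∂P, ∀ t : ℝ≥0, 0 < t → (∃ n, rides.completion n ω = t) →
    rides.stateAt M t ω = p.afterCompletion (rides.stateBefore M t ω)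
  step_none : ∀ᵐ ω ∂P, ∀ t : ℝ≥0, 0 < t →
    (∀ n, rides.request n ω ≠ t ∧ rides.completion n ω ≠ t) →
    rides.stateAt M t ω = rides.stateBefore M t ω
  /-- requests arrive at the effective request rate of the current state -/
  request_intensity : HasIntensity P F rides.request
    (fun t ω => ENNReal.ofReal (p.rate (rides.stateAt M t ω)))
  /-- each driver in service completes his ride at rate `μ_{l,m}` in state `(l, m)` -/
  completion_intensity : ∀ n, HasIntensity P F (fun _ : Unit => rides.completion n)
    (fun t ω => Set.indicator {s : ℝ≥0∞ | rides.dispatch n ω ≤ s ∧ s < rides.completion n ω}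
      (fun _ => ENNReal.ofReal
        (M.mu (rides.stateAt M t ω).1.val (rides.stateAt M t ω).2)) t)
  /-- on-trip times have the given law, and the on-trip time of a ride is independent of its
  request time, of the state that the rider found (hence of the price quoted to her), and of the
  dispatch time -/
  trip_law : ∀ n, P.map (rides.trip n) = M.tripLaw
  trip_indep : ∀ n, IndepFun (rides.trip n)
    (fun ω => (rides.request n ω, rides.stateBefore M (rides.request n ω).toNNReal ω,
      rides.dispatch n ω)) P
  /-- steady state -/
  stationary : ∀ (t : ℝ≥0) (x : M.State), P {ω | rides.stateAt M t ω = x} = π x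

namespace SteadyState

variable {M : Model} {p : M.Policy} (S : SteadyState M p)

/-- Expected revenue collected in `(0, T]` with base fare `p0`: ride `n`, requested in state `x`,
pays `p0 + p₁(λ(x)) d` for a trip of distance `d = trip n`. -/
def expectedRevenue (p0 : ℝ) (T : ℝ) : ℝ :=
  letI := S.mΩ
  (∫⁻ ω, ∑' n, Set.indicator (Set.Ioc 0 (ENNReal.ofReal T))
    (fun s => ENNReal.ofReal
      (p0 + M.price (p.rate (S.rides.stateBefore M s.toNNReal ω)) * (S.rides.trip n ω : ℝ)))
    (S.rides.request n ω) ∂S.P).toReal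

/-- `𝓡(λ, φ; p₀)`: long-run average revenue rate. -/
def revenueRate (p0 : ℝ) : ℝ := limUnder atTop (fun T : ℝ => S.expectedRevenue p0 T / T)

/-- `L_s^d`: expected number of drivers in service. -/
def meanInService : ℝ := ∑' x, (S.π x).toReal * (x.1.val : ℝ)

/-- `L_o^d`: expected number of idle drivers. -/
def meanIdle : ℝ := ∑' x, (S.π x).toReal * ((M.L : ℝ) - (x.1.val : ℝ))

/-- `L_q^r`: expected number of riders in the queue (possibly infinite). -/
def meanInQueue : ℝ≥0∞ := ∑' x, S.π x * (x.2 : ℝ≥0∞)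

/-- Expected time average over `[0, T]` of the number of riders waiting to be picked up. -/
def averageInPickup (T : ℝ) : ℝ :=
  letI := S.mΩ
  (∫⁻ ω, (∫⁻ t in Set.Icc (0 : ℝ) T, (S.rides.numInPickup t.toNNReal ω : ℝ≥0∞)) ∂S.P).toReal / T

/-- `L_p^r`: expected number of riders waiting to be picked up, in the long run. -/
def meanInPickup : ℝ := limUnder atTop S.averageInPickup

/-- Revenue rate minus operating costs minus waiting penalties; it is `-∞` if the expected queue
length is infinite. -/
def objective (p0 ws wo wp wq : ℝ) : EReal :=
  ((S.revenueRate p0 - ws * S.meanInService - wo * S.meanIdle - wp * S.meanInPickup : ℝ) : EReal) -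
    ((ENNReal.ofReal wq * S.meanInQueue : ℝ≥0∞) : EReal)

/-- Revenue rate minus a cost for drivers in service minus a queueing penalty. -/
def reducedObjective (p0 cd cr : ℝ) : EReal :=
  ((S.revenueRate p0 - cd * S.meanInService : ℝ) : EReal) -
    ((ENNReal.ofReal cr * S.meanInQueue : ℝ≥0∞) : EReal)

end SteadyState

/-- The set of maximizers. -/
def argmax {α : Type*} (f : α → EReal) : Set α := {a | ∀ b, f b ≤ f a}

end RideHailing

end

/-! Let A (`throughput`) be the stationary mean of λ, B (`priceFlow`) that of p₁(λ)λ, and L_s the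
mean number of drivers in service. Three identities reduce the theorem to linear algebra. Since the
trip distance is independent of the state found on requesting, the revenue rate is p₀A + t₀B
(`revenueRate_eq`). Idle drivers number L − L_s (`meanIdle_eq`). Riders in pick-up number L_s − t₀A
(`meanInPickup_eq`). So the pick-up penalty pays back w_p t₀ per rider, exactly like a higher base
fare, and the objectives differ by the constant w_o L (`reducedObjective_eq`).

The third identity is Little's law for the on-trip phase (`tendsto_tripTime`). On-trip time up to T
is compared with the sum of the trips of all rides dispatched by T. That selection depends on
dispatch times alone, so independence (`lintegral_tsum_trip`) gives t₀ times the expected number of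
such rides. The latter is L_s + TA: rides in service at T plus rides completed in (0, T]
(`lintegral_tsum_dispatch`), where completions occur at mean rate A by flow balance
(`Policy.IsStationary.tsum_completionRate`). Rides unfinished at T are not selected independently of
their trips; truncating trips at a level K makes their contribution o(T). -/

namespace RideHailing

namespace Model

variable {M : Model}

/-! ### Flow balance of the chain. -/

/-- The number of riders in the system, in service or in the queue. -/
def State.total (x : M.State) : ℕ := x.1.val + x.2

/-- A dispatch only moves a rider from the queue into service, so the dispatching rule drops out of
every argument about the total. -/
lemma total_settle (φ : M.State → Bool) (m : ℕ) (l : Fin (M.L + 1)) :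
    State.total (settle φ l m) = l.val + m := by
  induction m generalizing l with
  | zero => simp [settle, State.total]
  | succ m ih =>
    rw [settle]
    split_ifs with h
    · rw [ih]; simp only; omega
    · rfl

lemma Policy.total_afterRequest (p : M.Policy) (x : M.State) :
    State.total (p.afterRequest x) = State.total x + 1 := by
  rw [Policy.afterRequest, total_settle, State.total]; omega

lemma Policy.total_afterCompletion (p : M.Policy) (x : M.State) :
    State.total (p.afterCompletion x) = x.1.val - 1 + x.2 := by
  rw [Policy.afterCompletion, total_settle]

lemma completionRate_le (b : ℝ) (hb : ∀ l m, l ≤ M.L → M.mu l m ≤ b) (x : M.State) :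
    completionRate x ≤ M.L * b := by
  have h1 : x.1.val ≤ M.L := Nat.lt_succ_iff.1 x.1.isLt
  unfold completionRate
  have : (x.1.val : ℝ) ≤ M.L := by exact_mod_cast h1
  exact mul_le_mul this (hb _ _ h1) (M.mu_pos _ _ h1).le (by positivity)

lemma tsum_pmf_mul_le (π : PMF M.State) {f : M.State → ℝ≥0∞} {c : ℝ≥0∞} (hf : ∀ x, f x ≤ c) :
    ∑' x, π x * f x ≤ c := by
  calc ∑' x, π x * f x ≤ ∑' x, π x * c := ENNReal.tsum_le_tsum fun x => by gcongr; exact hf x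
    _ = c := by rw [ENNReal.tsum_mul_right, π.tsum_coe, one_mul]

lemma Policy.tsum_rate_ne_top (p : M.Policy) (π : PMF M.State) :
    ∑' x, π x * ENNReal.ofReal (p.rate x) ≠ ∞ :=
  ne_top_of_le_ne_top ENNReal.ofReal_ne_top
    (tsum_pmf_mul_le π fun x => ENNReal.ofReal_le_ofReal (p.rate_mem x).2)

lemma tsum_completionRate_ne_top (π : PMF M.State) :
    ∑' x, π x * ENNReal.ofReal (completionRate x) ≠ ∞ := by
  obtain ⟨b, -, hb⟩ := M.mu_bdd
  exact ne_top_of_le_ne_top ENNReal.ofReal_ne_top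
    (tsum_pmf_mul_le π fun x => ENNReal.ofReal_le_ofReal (completionRate_le b hb x))

/-- The flow across the cut between `k` and `k + 1` riders in the system is balanced. -/
lemma Policy.IsStationary.cut_balance {p : M.Policy} {π : PMF M.State} (h : p.IsStationary π)
    (k : ℕ) :
    ∑' x, π x * ENNReal.ofReal (completionRate x) * (if State.total x = k + 1 then 1 else 0) =
      ∑' x, π x * ENNReal.ofReal (p.rate x) * (if State.total x = k then 1 else 0) := by
  classical
  set a : M.State → ℝ≥0∞ := fun x => ENNReal.ofReal (p.rate x) with ha
  set b : M.State → ℝ≥0∞ := fun x => ENNReal.ofReal (completionRate x) with hb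
  -- Summing the balance equations against this indicator leaves only the flows across the cut.
  set f : M.State → ℝ≥0∞ := fun y => if State.total y ≤ k then 1 else 0 with hf
  have hout : ∀ y, ∑' z, p.transitionRate y z = a y + b y := by
    intro y
    simp only [Policy.transitionRate, ENNReal.tsum_add]
    rw [tsum_ite_eq' , tsum_ite_eq']
  have hin : ∀ x, ∑' y, p.transitionRate x y * f y =
      a x * f (p.afterRequest x) + b x * f (p.afterCompletion x) := by
    intro x
    simp only [Policy.transitionRate, add_mul, ite_mul, zero_mul, ENNReal.tsum_add]
    congr 1
    · rw [tsum_eq_single (p.afterRequest x) (by intro y hy; simp [hy.symm])]; simp [ha]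
    · rw [tsum_eq_single (p.afterCompletion x) (by intro y hy; simp [hy.symm])]; simp [hb]
  have key : ∑' x, π x * (a x * f (p.afterRequest x) + b x * f (p.afterCompletion x)) =
      ∑' x, π x * (a x + b x) * f x := by
    calc _ = ∑' x, ∑' y, π x * p.transitionRate x y * f y := by
          refine tsum_congr fun x => ?_
          rw [← hin, ← ENNReal.tsum_mul_left]
          simp only [mul_assoc]
      _ = ∑' y, ∑' x, π x * p.transitionRate x y * f y := ENNReal.tsum_comm
      _ = _ := by
          refine tsum_congr fun y => ?_
          rw [ENNReal.tsum_mul_right, h.2 y, hout]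
  have hb1 : ∀ x, b x * f (p.afterCompletion x) =
      b x * f x + b x * (if State.total x = k + 1 then 1 else 0) := by
    intro x
    -- With no driver in service the truncated subtraction in `afterCompletion` lowers no total, but
    -- the completion rate vanishes.
    by_cases hx : x.1.val = 0
    · have : b x = 0 := by simp [hb, completionRate, hx]
      simp [this]
    · rw [← mul_add]
      congr 1
      simp only [hf, Policy.total_afterCompletion]
      have : State.total x = x.1.val + x.2 := rfl
      split_ifs <;> first | omega | simp
  have ha1 : ∀ x, a x * f x = a x * f (p.afterRequest x) +
      a x * (if State.total x = k then 1 else 0) := by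
    intro x
    rw [← mul_add]
    congr 1
    simp only [hf, Policy.total_afterRequest]
    split_ifs <;> first | omega | simp
  -- The flow common to both sides is finite because the rates are bounded, so it may be cancelled
  -- in `ℝ≥0∞`.
  have hfin : ∑' x, π x * (a x * f (p.afterRequest x) + b x * f x) ≠ ∞ := by
    have : ∑' x, π x * (a x + b x) ≠ ∞ := by
      simp only [mul_add, ENNReal.tsum_add]
      exact ENNReal.add_ne_top.2 ⟨p.tsum_rate_ne_top π, tsum_completionRate_ne_top π⟩
    refine ne_top_of_le_ne_top this (ENNReal.tsum_le_tsum fun x => ?_)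
    have hf1 : ∀ y, f y ≤ 1 := fun y => by simp only [hf]; split_ifs <;> simp
    gcongr
    · exact mul_le_of_le_one_right' (hf1 _)
    · exact mul_le_of_le_one_right' (hf1 _)
  rw [← ENNReal.add_right_inj hfin, ← ENNReal.tsum_add, ← ENNReal.tsum_add]
  calc _ = ∑' x, π x * (a x * f (p.afterRequest x) + b x * f (p.afterCompletion x)) := by
        refine tsum_congr fun x => ?_
        rw [hb1]; ring
    _ = _ := key
    _ = _ := by
        refine tsum_congr fun x => ?_
        rw [mul_assoc, add_mul, ha1]; ring

/-- In steady state riders join the system as often as rides are completed. -/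
lemma Policy.IsStationary.tsum_completionRate {p : M.Policy} {π : PMF M.State}
    (h : p.IsStationary π) :
    ∑' x, π x * ENNReal.ofReal (completionRate x) = ∑' x, π x * ENNReal.ofReal (p.rate x) := by
  -- The cut equations are summed over k instead of testing balance against the total itself, whose
  -- stationary mean may be infinite.
  calc _ = ∑' x, ∑' k, π x * ENNReal.ofReal (completionRate x) *
            (if State.total x = k + 1 then 1 else 0) := by
        refine tsum_congr fun x => ?_
        rw [ENNReal.tsum_mul_left]
        by_cases hx : State.total x = 0
        · have : x.1.val = 0 := by unfold State.total at hx; omega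
          simp [completionRate, this]
        · obtain ⟨j, hj⟩ := Nat.exists_eq_succ_of_ne_zero hx
          simp [hj]
    _ = ∑' k, ∑' x, π x * ENNReal.ofReal (p.rate x) * (if State.total x = k then 1 else 0) := by
        rw [ENNReal.tsum_comm]
        exact tsum_congr fun k => h.cut_balance k
    _ = _ := by
        rw [ENNReal.tsum_comm]
        refine tsum_congr fun x => ?_
        rw [ENNReal.tsum_mul_left, tsum_ite_eq']
        simp

lemma price_mem {lam : ℝ} (h : lam ∈ Set.Icc 0 M.Lam) : M.price lam ∈ Set.Icc 0 M.pmax := by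
  apply Function.invFunOn_mem
  have h1 : lam / M.Lam ∈ Set.Icc (0 : ℝ) 1 :=
    ⟨div_nonneg h.1 M.Lam_pos.le, (div_le_one M.Lam_pos).2 h.2⟩
  obtain ⟨q, hq, he⟩ := M.tail_bijOn.surjOn h1
  refine ⟨q, hq, ?_⟩
  simp only at he ⊢
  rw [he, mul_div_cancel₀ _ M.Lam_pos.ne']

end Model

/-! ### Counting, predictability and measurability of the state. -/

lemma natCast_ncard_eq_tsum {s : Set ℕ} (hs : s.Finite) :
    (s.ncard : ℝ≥0∞) = ∑' n, s.indicator 1 n := by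
  rw [← tsum_subtype s]
  simp only [Pi.one_apply]
  rw [ENNReal.tsum_set_one, ← hs.cast_ncard_eq]
  simp

lemma measurable_ncard_setOf {α : Type*} [MeasurableSpace α] {s : ℕ → α → Prop}
    (hs : ∀ n, MeasurableSet {a | s n a}) : Measurable fun a => {n | s n a}.ncard :=
  measurable_ncard.comp (measurable_set_iff.2 fun n => measurableSet_setOfPred.1 (hs n))

lemma measurable_of_measurableSet_le {Ω : Type*} [MeasurableSpace Ω] {f : Ω → ℝ≥0∞}
    (h : ∀ t : ℝ≥0, MeasurableSet {ω | f ω ≤ t}) : Measurable f := by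
  refine measurable_of_Iic fun a => ?_
  induction a with
  | top => simp
  | coe t => exact h t

/-- The process `t ↦ 1{τ < t}` is predictable if the process `t ↦ 1{τ ≤ t}` is adapted. -/
lemma measurableSet_predictable_lt {Ω : Type*} {mΩ : MeasurableSpace Ω} {F : Filtration ℝ≥0 mΩ}
    {τ : Ω → ℝ≥0∞} (h : ∀ t, MeasurableSet[F t] {ω | τ ω ≤ t}) :
    MeasurableSet[F.predictable] {z : ℝ≥0 × Ω | τ z.2 < z.1} := by
  -- A rational between τ and t writes the set as a countable union of the rectangles (q, ∞) × {τ ≤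
  -- q}, which are predictable.
  have : {z : ℝ≥0 × Ω | τ z.2 < z.1} =
      ⋃ q : {q : ℚ // 0 ≤ q}, Set.Ioi (Real.toNNReal (q : ℚ)) ×ˢ
        {ω | τ ω ≤ (Real.toNNReal (q : ℚ) : ℝ≥0)} := by
    ext ⟨t, ω⟩
    simp only [Set.mem_ofPred_eq, Set.mem_iUnion, Set.mem_prod, Set.mem_Ioi, Subtype.exists]
    constructor
    · intro hlt
      obtain ⟨q, hq0, h1, h2⟩ := ENNReal.lt_iff_exists_rat_btwn.1 hlt
      exact ⟨q, hq0, ENNReal.coe_lt_coe.1 h2, h1.le⟩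
    · rintro ⟨q, hq0, h1, h2⟩
      exact h2.trans_lt (ENNReal.coe_lt_coe.2 h1)
  rw [this]
  exact MeasurableSet.iUnion fun q => measurableSet_predictable_Ioi_prod (h _)

lemma measurableSet_predictable_le_const {Ω : Type*} {mΩ : MeasurableSpace Ω}
    {F : Filtration ℝ≥0 mΩ} (T : ℝ≥0) :
    MeasurableSet[F.predictable] {z : ℝ≥0 × Ω | z.1 ≤ T} := by
  have : {z : ℝ≥0 × Ω | z.1 ≤ T} = (Set.Ioi T ×ˢ Set.univ)ᶜ := by
    ext z; simp
  rw [this]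
  exact (measurableSet_predictable_Ioi_prod MeasurableSet.univ).compl

lemma HasIntensity.lintegral_Ioc {Ω ι : Type*} {mΩ : MeasurableSpace Ω} {P : Measure Ω}
    {F : Filtration ℝ≥0 mΩ} {τ : ι → Ω → ℝ≥0∞} {ρ : ℝ≥0 → Ω → ℝ≥0∞} (h : HasIntensity P F τ ρ)
    {G : ℝ≥0 × Ω → ℝ≥0∞} (hG : Measurable[F.predictable] G) (T : ℝ≥0) :
    ∫⁻ ω, ∑' i, (Set.Ioc 0 (T : ℝ≥0∞)).indicator (fun s => G (s.toNNReal, ω)) (τ i ω) ∂P =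
      ∫⁻ ω, (∫⁻ t in Set.Ioc 0 (T : ℝ), G (t.toNNReal, ω) * ρ t.toNNReal ω) ∂P := by
  convert h ({z : ℝ≥0 × Ω | z.1 ≤ T}.indicator G)
    (hG.indicator (measurableSet_predictable_le_const T)) using 1
  · refine lintegral_congr fun ω => tsum_congr fun i => ?_
    induction τ i ω with
    | top => simp
    | coe s =>
      simp only [Set.indicator_apply, Set.mem_Ioc, Set.mem_Ioo, Set.mem_ofPred_eq,
        ENNReal.coe_pos, ENNReal.coe_le_coe, ENNReal.coe_lt_top, ENNReal.toNNReal_coe, and_true]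
      by_cases h1 : 0 < s <;> by_cases h2 : s ≤ T <;> simp [h1, h2]
  · refine lintegral_congr fun ω => ?_
    have : Set.Ioc 0 (T : ℝ) = Set.Iic (T : ℝ) ∩ Set.Ioi 0 := by
      rw [Set.inter_comm, Set.Ioi_inter_Iic]
    rw [this, ← setLIntegral_indicator measurableSet_Iic]
    refine setLIntegral_congr_fun measurableSet_Ioi fun t ht => ?_
    simp only [Set.indicator_apply, Set.mem_Iic, Set.mem_ofPred_eq, Real.toNNReal_le_iff_le_coe,
      ite_mul, zero_mul]

namespace Rides

variable {Ω α : Type*} [MeasurableSpace α] (R : Rides Ω) (M : Model) {t : α → ℝ≥0} {w : α → Ω}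

/-- The parameter space is abstract so that one proof serves both the predictable σ-algebra on time
× Ω and evaluation at a random request time. -/
lemma measurable_stateBefore (hr : ∀ n, MeasurableSet {a | R.request n (w a) < t a})
    (hd : ∀ n, MeasurableSet {a | R.dispatch n (w a) < t a})
    (hc : ∀ n, MeasurableSet {a | R.completion n (w a) < t a}) :
    Measurable fun a => R.stateBefore M (t a) (w a) := by
  have key : ∀ X Y : ℕ → Ω → ℝ≥0∞, (∀ n, MeasurableSet {a | X n (w a) < t a}) →
      (∀ n, MeasurableSet {a | Y n (w a) < t a}) →
      Measurable fun a => {n | X n (w a) < t a ∧ t a ≤ Y n (w a)}.ncard := by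
    intro X Y hX hY
    have hY' : ∀ n, MeasurableSet {a | t a ≤ Y n (w a)} := fun n => by
      convert (hY n).compl using 1
      ext a
      simp
    exact measurable_ncard_setOf fun n => (hX n).inter (hY' n)
  refine Measurable.prodMk ?_ (key _ _ hr hd)
  exact (Measurable.of_discrete (f := fun k : ℕ =>
    (⟨min k M.L, Nat.lt_succ_of_le (min_le_right _ _)⟩ : Fin (M.L + 1)))).comp (key _ _ hd hc)

lemma measurable_stateAt (hr : ∀ n, MeasurableSet {a | R.request n (w a) ≤ t a})
    (hd : ∀ n, MeasurableSet {a | R.dispatch n (w a) ≤ t a})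
    (hc : ∀ n, MeasurableSet {a | R.completion n (w a) ≤ t a}) :
    Measurable fun a => R.stateAt M (t a) (w a) := by
  have key : ∀ X Y : ℕ → Ω → ℝ≥0∞, (∀ n, MeasurableSet {a | X n (w a) ≤ t a}) →
      (∀ n, MeasurableSet {a | Y n (w a) ≤ t a}) →
      Measurable fun a => {n | X n (w a) ≤ t a ∧ t a < Y n (w a)}.ncard := by
    intro X Y hX hY
    have hY' : ∀ n, MeasurableSet {a | t a < Y n (w a)} := fun n => by
      convert (hY n).compl using 1
      ext a
      simp
    exact measurable_ncard_setOf fun n => (hX n).inter (hY' n)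
  refine Measurable.prodMk ?_ (key _ _ hr hd)
  exact (Measurable.of_discrete (f := fun k : ℕ =>
    (⟨min k M.L, Nat.lt_succ_of_le (min_le_right _ _)⟩ : Fin (M.L + 1)))).comp (key _ _ hd hc)

end Rides

/-! ### Expected numbers of requests, completions and dispatches. -/

namespace SteadyState

attribute [local instance] SteadyState.mΩ SteadyState.prob

open Model

variable {M : Model} {p : M.Policy} (S : SteadyState M p)

lemma measurable_request (n : ℕ) : Measurable (S.rides.request n) :=
  measurable_of_measurableSet_le fun t => S.F.le t _ (S.request_adapted n t)

lemma measurable_dispatch (n : ℕ) : Measurable (S.rides.dispatch n) :=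
  measurable_of_measurableSet_le fun t => S.F.le t _ (S.dispatch_adapted n t)

lemma measurable_completion (n : ℕ) : Measurable (S.rides.completion n) :=
  measurable_of_measurableSet_le fun t => S.F.le t _ (S.completion_adapted n t)

lemma measurable_stateBefore_request (n : ℕ) :
    Measurable fun ω => S.rides.stateBefore M (S.rides.request n ω).toNNReal ω := by
  have ht : Measurable fun ω => (((S.rides.request n ω).toNNReal : ℝ≥0) : ℝ≥0∞) :=
    (S.measurable_request n).ennreal_toNNReal.coe_nnreal_ennreal
  exact S.rides.measurable_stateBefore M (w := fun ω => ω)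
    (fun k => measurableSet_lt (S.measurable_request k) ht)
    (fun k => measurableSet_lt (S.measurable_dispatch k) ht)
    (fun k => measurableSet_lt (S.measurable_completion k) ht)

lemma measurable_stateBefore_predictable :
    Measurable[S.F.predictable] fun z : ℝ≥0 × S.Ω => S.rides.stateBefore M z.1 z.2 :=
  @Rides.measurable_stateBefore _ _ S.F.predictable S.rides M Prod.fst Prod.snd
    (fun k => measurableSet_predictable_lt (S.request_adapted k))
    (fun k => measurableSet_predictable_lt (S.dispatch_adapted k))
    (fun k => measurableSet_predictable_lt (S.completion_adapted k))

lemma measurable_time : Measurable fun z : S.Ω × ℝ => ((z.2.toNNReal : ℝ≥0) : ℝ≥0∞) :=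
  measurable_snd.real_toNNReal.coe_nnreal_ennreal

lemma measurable_stateAt_uncurry :
    Measurable fun z : S.Ω × ℝ => S.rides.stateAt M z.2.toNNReal z.1 :=
  S.rides.measurable_stateAt M
    (fun k => measurableSet_le ((S.measurable_request k).comp measurable_fst) S.measurable_time)
    (fun k => measurableSet_le ((S.measurable_dispatch k).comp measurable_fst) S.measurable_time)
    (fun k => measurableSet_le ((S.measurable_completion k).comp measurable_fst) S.measurable_time)

lemma measurable_stateAt (t : ℝ≥0) : Measurable (S.rides.stateAt M t) := by
  have := S.measurable_stateAt_uncurry.comp (measurable_prodMk_right (y := (t : ℝ)))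
  simp only [Function.comp_def, Real.toNNReal_coe] at this
  exact this

lemma finite_dispatched : ∀ᵐ ω ∂S.P, ∀ t : ℝ≥0,
    {n | S.rides.dispatch n ω ≤ t}.Finite := by
  filter_upwards [S.locallyFinite, S.request_le_dispatch] with ω h1 h2 t
  exact (h1 t).subset fun n hn => (h2 n).trans hn

lemma stateAt_fst_eq : ∀ᵐ ω ∂S.P, ∀ t : ℝ≥0,
    (S.rides.stateAt M t ω).1.val = S.rides.numInService t ω := by
  filter_upwards [S.capacity] with ω h t
  exact min_eq_left (h t)

/-- Just before almost every time the state is the same as at that time. -/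
lemma stateBefore_ae_eq : ∀ᵐ ω ∂S.P, ∀ᵐ t : ℝ, 0 < t →
    S.rides.stateBefore M t.toNNReal ω = S.rides.stateAt M t.toNNReal ω := by
  filter_upwards [S.step_none] with ω h
  -- The state can jump only at request and completion times, which form a countable, hence null,
  -- set.
  have hc : ((Set.range fun n => (S.rides.request n ω).toReal) ∪
      Set.range fun n => (S.rides.completion n ω).toReal).Countable :=
    (Set.countable_range _).union (Set.countable_range _)
  filter_upwards [hc.ae_notMem volume] with t ht ht0
  refine (h _ (Real.toNNReal_pos.2 ht0) fun n => ⟨fun he => ht (Or.inl ⟨n, ?_⟩),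
    fun he => ht (Or.inr ⟨n, ?_⟩)⟩).symm
  all_goals simp [he, ht0.le]

lemma lintegral_stateAt (t : ℝ≥0) (g : M.State → ℝ≥0∞) :
    ∫⁻ ω, g (S.rides.stateAt M t ω) ∂S.P = ∑' x, S.π x * g x := by
  rw [← lintegral_map (f := g) (Measurable.of_discrete) (S.measurable_stateAt t),
    lintegral_countable']
  refine tsum_congr fun x => ?_
  rw [Measure.map_apply (S.measurable_stateAt t) (measurableSet_singleton x), mul_comm,
    ← S.stationary t x]
  rfl

/-- By Tonelli and stationarity, time integrals have exact expectations; no ergodic theorem is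
needed. -/
lemma lintegral_lintegral_stateAt (I : Set ℝ) (g : M.State → ℝ≥0∞) :
    ∫⁻ ω, (∫⁻ t in I, g (S.rides.stateAt M t.toNNReal ω)) ∂S.P =
      volume I * ∑' x, S.π x * g x := by
  have hm : Measurable (Function.uncurry fun (ω : S.Ω) (t : ℝ) =>
      g (S.rides.stateAt M t.toNNReal ω)) :=
    (Measurable.of_discrete (f := g)).comp S.measurable_stateAt_uncurry
  rw [lintegral_lintegral_swap hm.aemeasurable]
  simp only [lintegral_stateAt, lintegral_const, Measure.restrict_apply_univ, mul_comm]

/-- A sum over the requests up to time `T` of a function of the state found on requesting. -/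
lemma lintegral_tsum_request (g : M.State → ℝ≥0∞) (T : ℝ≥0) :
    ∫⁻ ω, ∑' n, (Set.Ioc 0 (T : ℝ≥0∞)).indicator
        (fun s => g (S.rides.stateBefore M s.toNNReal ω)) (S.rides.request n ω) ∂S.P =
      T * ∑' x, S.π x * (g x * ENNReal.ofReal (p.rate x)) := by
  -- The integrand must be predictable, so it uses the state just before t; under the time integral
  -- this is then replaced by the state at t.
  have h := S.request_intensity.lintegral_Ioc
    (G := fun z => g (S.rides.stateBefore M z.1 z.2))
    (Measurable.comp (Measurable.of_discrete (f := g)) S.measurable_stateBefore_predictable) T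
  refine h.trans ?_
  trans ∫⁻ ω, (∫⁻ t in Set.Ioc 0 (T : ℝ), (fun x => g x * ENNReal.ofReal (p.rate x))
      (S.rides.stateAt M t.toNNReal ω)) ∂S.P
  · refine lintegral_congr_ae ?_
    filter_upwards [S.stateBefore_ae_eq] with ω hω
    refine setLIntegral_congr_fun_ae measurableSet_Ioc ?_
    filter_upwards [hω] with t ht htI
    rw [ht htI.1]
  · rw [S.lintegral_lintegral_stateAt (Set.Ioc 0 (T : ℝ))
      fun x => g x * ENNReal.ofReal (p.rate x)]
    simp

lemma measurableSet_between {X Y : S.Ω → ℝ≥0∞} (hX : Measurable X) (hY : Measurable Y) :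
    MeasurableSet {z : S.Ω × ℝ | X z.1 ≤ z.2.toNNReal ∧ z.2.toNNReal < Y z.1} :=
  (measurableSet_le (hX.comp measurable_fst) S.measurable_time).inter
    (measurableSet_lt S.measurable_time (hY.comp measurable_fst))

/-- The individual completion intensities add up to l μ_{l,m}, and flow balance turns its stationary
mean into the mean request rate. -/
lemma lintegral_tsum_completion (T : ℝ≥0) :
    ∫⁻ ω, ∑' n, (Set.Ioc 0 (T : ℝ≥0∞)).indicator 1 (S.rides.completion n ω) ∂S.P =
      T * ∑' x, S.π x * ENNReal.ofReal (p.rate x) := by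
  classical
  set c : M.State → ℝ≥0∞ := fun x => ENNReal.ofReal (M.mu x.1.val x.2) with hcdef
  set J : ℕ → S.Ω → ℝ → ℝ≥0∞ := fun n ω t => Set.indicator
    {s : ℝ≥0∞ | S.rides.dispatch n ω ≤ s ∧ s < S.rides.completion n ω}
      (fun _ => c (S.rides.stateAt M t.toNNReal ω)) (t.toNNReal : ℝ≥0∞) with hJ
  have hJm : ∀ n, Measurable (Function.uncurry (J n)) := fun n =>
    ((Measurable.of_discrete (f := c)).comp S.measurable_stateAt_uncurry).indicator
      (S.measurableSet_between (S.measurable_dispatch n) (S.measurable_completion n))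
  have h1 : ∀ n, ∫⁻ ω, (Set.Ioc 0 (T : ℝ≥0∞)).indicator 1 (S.rides.completion n ω) ∂S.P =
      ∫⁻ ω, (∫⁻ t in Set.Ioc 0 (T : ℝ), J n ω t) ∂S.P := by
    intro n
    have := (S.completion_intensity n).lintegral_Ioc (G := fun _ => 1) measurable_const T
    simp only [tsum_fintype, Finset.univ_unique, Finset.sum_singleton, one_mul] at this
    exact this
  have hcm : ∀ n, Measurable fun ω => (Set.Ioc 0 (T : ℝ≥0∞)).indicator (1 : ℝ≥0∞ → ℝ≥0∞)
      (S.rides.completion n ω) := fun n =>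
    (measurable_one.indicator measurableSet_Ioc).comp (S.measurable_completion n)
  rw [lintegral_tsum fun n => (hcm n).aemeasurable]
  simp only [h1]
  rw [← lintegral_tsum fun n => (hJm n).lintegral_prod_right.aemeasurable,
    ← S.isStationary.tsum_completionRate]
  trans ∫⁻ ω, (∫⁻ t in Set.Ioc 0 (T : ℝ), (fun x => ENNReal.ofReal (completionRate x))
      (S.rides.stateAt M t.toNNReal ω)) ∂S.P
  · refine lintegral_congr_ae ?_
    filter_upwards [S.finite_dispatched, S.stateAt_fst_eq] with ω hfin hst
    have hJω : ∀ n, Measurable (J n ω) := fun n => (hJm n).comp measurable_prodMk_left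
    rw [← lintegral_tsum fun n => (hJω n).aemeasurable]
    refine lintegral_congr fun t => ?_
    have hf : {n | S.rides.dispatch n ω ≤ t.toNNReal ∧
        t.toNNReal < S.rides.completion n ω}.Finite := (hfin t.toNNReal).subset fun n hn => hn.1
    have : ∀ n, J n ω t = {n | S.rides.dispatch n ω ≤ t.toNNReal ∧
        t.toNNReal < S.rides.completion n ω}.indicator 1 n *
          c (S.rides.stateAt M t.toNNReal ω) := by
      intro n
      simp [hJ, Set.indicator_apply]
    simp only [this]
    rw [ENNReal.tsum_mul_right, ← natCast_ncard_eq_tsum hf]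
    simp only [completionRate, hcdef]
    rw [ENNReal.ofReal_mul (by positivity), ENNReal.ofReal_natCast, hst]
    rfl
  · rw [S.lintegral_lintegral_stateAt (Set.Ioc 0 (T : ℝ))
      fun x => ENNReal.ofReal (completionRate x)]
    simp

lemma tsum_between_eq_numInService : ∀ᵐ ω ∂S.P, ∀ t : ℝ≥0,
    ∑' n, {n | S.rides.dispatch n ω ≤ t ∧ t < S.rides.completion n ω}.indicator
      (1 : ℕ → ℝ≥0∞) n = ((S.rides.stateAt M t ω).1.val : ℝ≥0∞) := by
  filter_upwards [S.finite_dispatched, S.stateAt_fst_eq] with ω hfin hst t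
  rw [hst, Rides.numInService, natCast_ncard_eq_tsum ((hfin t).subset fun n hn => hn.1)]

/-- The expected number of rides dispatched up to time `T`. -/
lemma lintegral_tsum_dispatch (T : ℝ≥0) :
    ∫⁻ ω, ∑' n, (Set.Iic (T : ℝ≥0∞)).indicator 1 (S.rides.dispatch n ω) ∂S.P =
      ∑' x, S.π x * (x.1.val : ℝ≥0∞) + T * ∑' x, S.π x * ENNReal.ofReal (p.rate x) := by
  have hm : Measurable fun ω => ((S.rides.stateAt M T ω).1.val : ℝ≥0∞) :=
    (Measurable.of_discrete (f := fun x : M.State => (x.1.val : ℝ≥0∞))).comp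
      (S.measurable_stateAt T)
  rw [← lintegral_tsum_completion, ← S.lintegral_stateAt T fun x => (x.1.val : ℝ≥0∞),
    ← lintegral_add_left hm]
  refine lintegral_congr_ae ?_
  filter_upwards [S.tsum_between_eq_numInService, S.dispatch_le_pickup, S.completion_pos]
    with ω h1 h2 h3
  rw [← h1, ← ENNReal.tsum_add]
  refine tsum_congr fun n => ?_
  have hdc : S.rides.dispatch n ω ≤ S.rides.completion n ω := (h2 n).trans le_self_add
  simp only [Set.indicator_apply, Set.mem_Iic, Set.mem_Ioc, Set.mem_ofPred_eq, Pi.one_apply, h3 n,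
    true_and]
  -- A ride dispatched by T is either completed in (0, T] or still in service at T; positivity of
  -- completion times excludes a third case.
  rcases le_or_gt (S.rides.completion n ω) T with h | h
  · simp [h, hdc.trans h, h.not_gt]
  · simp [h, h.not_ge]

/-- On-trip times can be averaged separately in sums over the rides. -/
lemma lintegral_tsum_trip {h : ℝ≥0 → ℝ≥0∞} (hh : Measurable h)
    {k : ℝ≥0∞ × M.State × ℝ≥0∞ → ℝ≥0∞} (hk : Measurable k) :
    ∫⁻ ω, ∑' n, h (S.rides.trip n ω) * k (S.rides.request n ω,
        S.rides.stateBefore M (S.rides.request n ω).toNNReal ω, S.rides.dispatch n ω) ∂S.P =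
      (∫⁻ y, h y ∂M.tripLaw) * ∫⁻ ω, ∑' n, k (S.rides.request n ω,
        S.rides.stateBefore M (S.rides.request n ω).toNNReal ω, S.rides.dispatch n ω) ∂S.P := by
  have hm : ∀ n, Measurable fun ω => k (S.rides.request n ω,
        S.rides.stateBefore M (S.rides.request n ω).toNNReal ω, S.rides.dispatch n ω) := fun n =>
    hk.comp ((S.measurable_request n).prodMk
      ((S.measurable_stateBefore_request n).prodMk (S.measurable_dispatch n)))
  have hhm : ∀ n, Measurable fun ω => h (S.rides.trip n ω) := fun n =>
    hh.comp (S.measurable_trip n)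
  have hhk : ∀ n, Measurable fun ω => h (S.rides.trip n ω) * k (S.rides.request n ω,
        S.rides.stateBefore M (S.rides.request n ω).toNNReal ω, S.rides.dispatch n ω) := fun n =>
    (hhm n).mul (hm n)
  rw [lintegral_tsum fun n => (hhk n).aemeasurable,
    lintegral_tsum fun n => (hm n).aemeasurable, ← ENNReal.tsum_mul_left]
  refine tsum_congr fun n => ?_
  rw [lintegral_mul_eq_lintegral_mul_lintegral_of_indepFun'' (hhm n).aemeasurable
    (hm n).aemeasurable ((S.trip_indep n).comp hh hk), ← S.trip_law n,
    lintegral_map hh (S.measurable_trip n)]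

end SteadyState

/-! ### Deterministic estimates for trip intervals, tails and linear growth. -/

lemma volume_between_le (q : ℝ≥0∞) (d : ℝ≥0) (I : Set ℝ) (hI : I ⊆ Set.Ici 0) :
    volume ({t : ℝ | q ≤ t.toNNReal ∧ t.toNNReal < q + d} ∩ I) ≤ d := by
  induction q with
  | top => simp
  | coe q =>
    calc _ ≤ volume (Set.Ico (q : ℝ) (q + d)) := by
          refine measure_mono fun t ht => ?_
          obtain ⟨⟨h1, h2⟩, h3⟩ := ht
          have h0 : ((t.toNNReal : ℝ≥0) : ℝ) = t := Real.coe_toNNReal t (hI h3)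
          have h1' : (q : ℝ) ≤ t.toNNReal := by exact_mod_cast h1
          have h2' : (t.toNNReal : ℝ) < q + d := by exact_mod_cast h2
          rw [h0] at h1' h2'
          exact ⟨h1', h2'⟩
      _ = d := by simp

lemma volume_between_eq (q : ℝ≥0∞) (d T : ℝ≥0) (h : q + d ≤ T) :
    volume ({t : ℝ | q ≤ t.toNNReal ∧ t.toNNReal < q + d} ∩ Set.Icc 0 (T : ℝ)) = d := by
  refine le_antisymm (volume_between_le q d _ fun t ht => ht.1) ?_
  induction q with
  | top => simp at h
  | coe q =>
    have h' : (q : ℝ) + d ≤ T := by exact_mod_cast h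
    calc (d : ℝ≥0∞) = volume (Set.Ico (q : ℝ) (q + d)) := by simp
      _ ≤ _ := by
          refine measure_mono fun t ht => ?_
          have h0 : 0 ≤ t := q.2.trans ht.1
          have h1 : ((t.toNNReal : ℝ≥0) : ℝ) = t := Real.coe_toNNReal t h0
          refine ⟨⟨?_, ?_⟩, h0, ht.2.le.trans h'⟩
          · exact_mod_cast (show (q : ℝ) ≤ t.toNNReal by rw [h1]; exact ht.1)
          · exact_mod_cast (show (t.toNNReal : ℝ) < q + d by rw [h1]; exact ht.2)

lemma volume_between_eq_zero (q : ℝ≥0∞) (d T : ℝ≥0) (h : T < q) :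
    volume ({t : ℝ | q ≤ t.toNNReal ∧ t.toNNReal < q + d} ∩ Set.Icc 0 (T : ℝ)) = 0 := by
  convert measure_empty (μ := (volume : Measure ℝ))
  refine Set.eq_empty_of_forall_notMem fun t ht => ?_
  have h1 : (t.toNNReal : ℝ≥0∞) ≤ T :=
    ENNReal.coe_le_coe.2 (Real.toNNReal_le_iff_le_coe.2 ht.2.2)
  exact (h.trans_le (ht.1.1.trans h1)).false

lemma tendsto_lintegral_tail {μ : Measure ℝ≥0} (h : ∫⁻ y, (y : ℝ≥0∞) ∂μ ≠ ∞) :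
    Tendsto (fun K : ℕ => ∫⁻ y, (Set.Ioi (K : ℝ≥0)).indicator (fun y => (y : ℝ≥0∞)) y ∂μ)
      atTop (𝓝 0) := by
  rw [← lintegral_zero (μ := μ)]
  refine tendsto_lintegral_of_dominated_convergence (fun y => (y : ℝ≥0∞))
    (fun K => measurable_coe_nnreal_ennreal.indicator measurableSet_Ioi)
    (fun K => ae_of_all _ fun y => Set.indicator_le_self _ _ _) h (ae_of_all _ fun y => ?_)
  obtain ⟨k, hk⟩ := exists_nat_ge y
  refine tendsto_const_nhds.congr' ?_
  filter_upwards [eventually_ge_atTop k] with K hK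
  have : y ≤ (K : ℝ≥0) := hk.trans (by exact_mod_cast hK)
  simp [this]

/-- A function of linear growth, from an upper bound and approximate lower bounds. -/
lemma tendsto_div_of_linear_bounds {v : ℝ → ℝ} {e : ℕ → ℝ} {c l a : ℝ}
    (he : Tendsto e atTop (𝓝 0)) (hup : ∀ T > 0, v T ≤ c * (l + T * a))
    (hlow : ∀ K : ℕ, ∀ T > 0, c * (l + T * a) ≤ v T + K * l + e K * (l + T * a)) :
    Tendsto (fun T => v T / T) atTop (𝓝 (c * a)) := by
  have hinv : ∀ x : ℝ, Tendsto (fun T : ℝ => x / T) atTop (𝓝 0) := fun x =>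
    tendsto_const_nhds.div_atTop tendsto_id
  refine tendsto_order.2 ⟨fun b hb => ?_, fun b hb => ?_⟩
  · have h1 : Tendsto (fun K => c * a - e K * a) atTop (𝓝 (c * a)) := by
      simpa using tendsto_const_nhds.sub (he.mul_const a)
    -- K is fixed before T grows, so that the term K * l is negligible against T.
    obtain ⟨K, hK⟩ := (h1.eventually (lt_mem_nhds hb)).exists
    have h2 : Tendsto (fun T : ℝ => (c * a - e K * a) + (c * l - K * l - e K * l) / T) atTop
        (𝓝 (c * a - e K * a)) := by
      simpa using tendsto_const_nhds.add (hinv (c * l - K * l - e K * l))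
    filter_upwards [h2.eventually (lt_mem_nhds hK), eventually_gt_atTop 0] with T hT hT0
    refine hT.trans_le ?_
    rw [le_div_iff₀ hT0, add_mul, div_mul_cancel₀ _ hT0.ne']
    linarith [hlow K T hT0]
  · have h2 : Tendsto (fun T : ℝ => c * a + c * l / T) atTop (𝓝 (c * a)) := by
      simpa using tendsto_const_nhds.add (hinv (c * l))
    filter_upwards [h2.eventually (gt_mem_nhds hb), eventually_gt_atTop 0] with T hT hT0
    refine lt_of_le_of_lt ?_ hT
    rw [div_le_iff₀ hT0, add_mul, div_mul_cancel₀ _ hT0.ne']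
    linarith [hup T hT0]

/-! ### Long-run averages and comparison of the objectives. -/

namespace SteadyState

attribute [local instance] SteadyState.mΩ SteadyState.prob

open Model

variable {M : Model} {p : M.Policy} (S : SteadyState M p)

/-- The rate at which riders join the system in steady state. -/
noncomputable def throughput : ℝ≥0∞ := ∑' x, S.π x * ENNReal.ofReal (p.rate x)

/-- The stationary mean of the rate at which prices per kilometre are quoted and accepted. -/
noncomputable def priceFlow : ℝ≥0∞ :=
  ∑' x, S.π x * (ENNReal.ofReal (M.price (p.rate x)) * ENNReal.ofReal (p.rate x))

lemma throughput_ne_top : S.throughput ≠ ∞ := p.tsum_rate_ne_top S.π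

lemma priceFlow_ne_top : S.priceFlow ≠ ∞ := by
  refine ne_top_of_le_ne_top (b := ENNReal.ofReal M.pmax * ENNReal.ofReal M.Lam)
    (by finiteness) (tsum_pmf_mul_le S.π fun x => ?_)
  gcongr
  · exact (price_mem (p.rate_mem x)).2
  · exact (p.rate_mem x).2

lemma tsum_inService_ne_top : ∑' x, S.π x * (x.1.val : ℝ≥0∞) ≠ ∞ :=
  ne_top_of_le_ne_top (b := (M.L : ℝ≥0∞)) (by finiteness)
    (tsum_pmf_mul_le S.π fun x => by exact_mod_cast Nat.lt_succ_iff.1 x.1.isLt)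

lemma toReal_tsum_inService :
    (∑' x, S.π x * (x.1.val : ℝ≥0∞)).toReal = S.meanInService := by
  rw [ENNReal.tsum_toReal_eq fun x => by have := S.π.apply_ne_top x; finiteness]
  simp [meanInService]

lemma ofReal_meanInService :
    ENNReal.ofReal S.meanInService = ∑' x, S.π x * (x.1.val : ℝ≥0∞) := by
  rw [← toReal_tsum_inService, ENNReal.ofReal_toReal S.tsum_inService_ne_top]

lemma meanInService_nonneg : 0 ≤ S.meanInService := by
  rw [← toReal_tsum_inService]; exact ENNReal.toReal_nonneg

lemma meanIdle_eq : S.meanIdle = M.L - S.meanInService := by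
  have h1 : Summable fun x => (S.π x).toReal := ENNReal.summable_toReal S.π.tsum_coe_ne_top
  have h2 : Summable fun x => (S.π x).toReal * (x.1.val : ℝ) := by
    refine (ENNReal.summable_toReal S.tsum_inService_ne_top).congr fun x => by simp
  have h3 : ∑' x, (S.π x).toReal = 1 := by
    rw [← ENNReal.tsum_toReal_eq S.π.apply_ne_top, S.π.tsum_coe, ENNReal.toReal_one]
  simp only [meanIdle, mul_sub]
  rw [(h1.mul_right _).tsum_sub h2, tsum_mul_right, h3, one_mul, meanInService]

/-- Revenue is exactly linear in T: the fare is paid in full on requesting, and the distance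
averages to t₀ independently of the quoted price. -/
lemma expectedRevenue_eq {p0 : ℝ} (hp0 : 0 ≤ p0) (T : ℝ≥0) :
    S.expectedRevenue p0 T =
      T * (p0 * S.throughput.toReal + M.t0 * S.priceFlow.toReal) := by
  set k : (M.State → ℝ≥0∞) → ℝ≥0∞ × M.State × ℝ≥0∞ → ℝ≥0∞ :=
    fun g z => (Set.Ioc 0 (T : ℝ≥0∞)).indicator (fun _ => g z.2.1) z.1 with hkdef
  have hk : ∀ g, Measurable (k g) := fun g =>
    ((Measurable.of_discrete (f := g)).comp measurable_snd.fst).indicator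
      (measurable_fst measurableSet_Ioc)
  have hkint : ∀ g : M.State → ℝ≥0∞, ∫⁻ ω, ∑' n, k g (S.rides.request n ω,
      S.rides.stateBefore M (S.rides.request n ω).toNNReal ω, S.rides.dispatch n ω) ∂S.P =
        T * ∑' x, S.π x * (g x * ENNReal.ofReal (p.rate x)) := fun g =>
    S.lintegral_tsum_request g T
  have hkm : ∀ g : M.State → ℝ≥0∞, Measurable fun ω => ∑' n, k g (S.rides.request n ω,
      S.rides.stateBefore M (S.rides.request n ω).toNNReal ω, S.rides.dispatch n ω) := fun g =>
    Measurable.tsum fun n => (hk g).comp ((S.measurable_request n).prodMk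
      ((S.measurable_stateBefore_request n).prodMk (S.measurable_dispatch n)))
  set g1 : M.State → ℝ≥0∞ := fun _ => ENNReal.ofReal p0
  set g2 : M.State → ℝ≥0∞ := fun x => ENNReal.ofReal (M.price (p.rate x))
  have hsum : ∫⁻ ω, ∑' n, Set.indicator (Set.Ioc 0 (ENNReal.ofReal T))
      (fun s => ENNReal.ofReal
        (p0 + M.price (p.rate (S.rides.stateBefore M s.toNNReal ω)) * (S.rides.trip n ω : ℝ)))
      (S.rides.request n ω) ∂S.P =
      T * (ENNReal.ofReal p0 * S.throughput + ENNReal.ofReal M.t0 * S.priceFlow) := by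
    trans ∫⁻ ω, (∑' n, k g1 (S.rides.request n ω,
        S.rides.stateBefore M (S.rides.request n ω).toNNReal ω, S.rides.dispatch n ω)) +
        ∑' n, (S.rides.trip n ω : ℝ≥0∞) * k g2 (S.rides.request n ω,
        S.rides.stateBefore M (S.rides.request n ω).toNNReal ω, S.rides.dispatch n ω) ∂S.P
    · refine lintegral_congr fun ω => ?_
      rw [← ENNReal.tsum_add]
      refine tsum_congr fun n => ?_
      have h0 : 0 ≤ M.price (p.rate (S.rides.stateBefore M
        (S.rides.request n ω).toNNReal ω)) := (price_mem (p.rate_mem _)).1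
      simp only [hkdef, Set.indicator_apply, ENNReal.ofReal_coe_nnreal]
      split_ifs
      · rw [ENNReal.ofReal_add hp0 (by positivity), ENNReal.ofReal_mul h0,
          ENNReal.ofReal_coe_nnreal, mul_comm (S.rides.trip n ω : ℝ≥0∞)]
      · simp
    · rw [lintegral_add_left (hkm g1), hkint, S.lintegral_tsum_trip measurable_coe_nnreal_ennreal
        (hk g2), hkint, M.tripLaw_mean]
      have h1 : ∑' x, S.π x * (g1 x * ENNReal.ofReal (p.rate x)) =
          ENNReal.ofReal p0 * S.throughput := by
        rw [throughput, ← ENNReal.tsum_mul_left]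
        exact tsum_congr fun x => by ring
      rw [h1, ← priceFlow]
      ring
  rw [expectedRevenue, hsum]
  have h1 := S.throughput_ne_top
  have h2 := S.priceFlow_ne_top
  rw [ENNReal.toReal_mul, ENNReal.toReal_add (by finiteness) (by finiteness), ENNReal.toReal_mul,
    ENNReal.toReal_mul, ENNReal.toReal_ofReal hp0, ENNReal.toReal_ofReal M.t0_pos.le,
    ENNReal.coe_toReal]

lemma tendsto_revenueRate {p0 : ℝ} (hp0 : 0 ≤ p0) :
    Tendsto (fun T : ℝ => S.expectedRevenue p0 T / T) atTop
      (𝓝 (p0 * S.throughput.toReal + M.t0 * S.priceFlow.toReal)) := by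
  refine tendsto_const_nhds.congr' ?_
  filter_upwards [eventually_gt_atTop 0] with T hT
  lift T to ℝ≥0 using hT.le
  rw [S.expectedRevenue_eq hp0, mul_div_cancel_left₀ _ hT.ne']

lemma revenueRate_eq {p0 : ℝ} (hp0 : 0 ≤ p0) :
    S.revenueRate p0 = p0 * S.throughput.toReal + M.t0 * S.priceFlow.toReal :=
  (S.tendsto_revenueRate hp0).limUnder_eq

/-- The total time spent on trip by all riders up to time `T`. -/
noncomputable def tripTime (T : ℝ≥0) (ω : S.Ω) : ℝ≥0∞ :=
  ∑' n, volume ({t : ℝ | S.rides.pickup n ω ≤ t.toNNReal ∧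
    t.toNNReal < S.rides.pickup n ω + S.rides.trip n ω} ∩ Set.Icc 0 (T : ℝ))

lemma tripTime_le (T : ℝ≥0) : ∀ᵐ ω ∂S.P, S.tripTime T ω ≤
    ∑' n, (S.rides.trip n ω : ℝ≥0∞) *
      (Set.Iic (T : ℝ≥0∞)).indicator 1 (S.rides.dispatch n ω) := by
  filter_upwards [S.dispatch_le_pickup] with ω h
  refine ENNReal.tsum_le_tsum fun n => ?_
  rcases le_or_gt (S.rides.dispatch n ω) T with hT | hT
  · simpa [hT] using volume_between_le (S.rides.pickup n ω) (S.rides.trip n ω) _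
      fun t (ht : t ∈ Set.Icc 0 (T : ℝ)) => ht.1
  · rw [volume_between_eq_zero _ _ _ (hT.trans_le (h n))]; simp

/-- Ride by ride: a trip finished by T lies wholly in [0, T]; an unfinished one of length at most K
is charged to a driver in service at T; a longer one falls into the tail sum, where independence
still applies. -/
lemma le_tripTime (T : ℝ≥0) (K : ℕ) : ∀ᵐ ω ∂S.P,
    ∑' n, (S.rides.trip n ω : ℝ≥0∞) *
      (Set.Iic (T : ℝ≥0∞)).indicator 1 (S.rides.dispatch n ω) ≤
    S.tripTime T ω + K * ((S.rides.stateAt M T ω).1.val : ℝ≥0∞) +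
      ∑' n, (Set.Ioi (K : ℝ≥0)).indicator (fun y => (y : ℝ≥0∞)) (S.rides.trip n ω) *
        (Set.Iic (T : ℝ≥0∞)).indicator 1 (S.rides.dispatch n ω) := by
  filter_upwards [S.tsum_between_eq_numInService] with ω h
  rw [← h, ← ENNReal.tsum_mul_left, tripTime, ← ENNReal.tsum_add, ← ENNReal.tsum_add]
  refine ENNReal.tsum_le_tsum fun n => ?_
  rcases le_or_gt (S.rides.dispatch n ω) T with hd | hd
  · rcases le_or_gt (S.rides.completion n ω) T with hc | hc
    · rw [volume_between_eq _ _ _ hc, add_assoc]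
      simp [hd]
    · rcases le_or_gt (S.rides.trip n ω) K with hK | hK
      · have hK' : (S.rides.trip n ω : ℝ≥0∞) ≤ K := by exact_mod_cast hK
        simp only [Set.indicator_apply, Set.mem_Iic, hd, Set.mem_ofPred_eq, hc, and_self, if_true,
          Pi.one_apply, mul_one]
        exact hK'.trans (le_add_self.trans le_self_add)
      · simp [hd, hK]
  · simp [hd.not_ge]

lemma measurable_tripTime (T : ℝ≥0) : Measurable (S.tripTime T) := by
  refine Measurable.tsum fun n => ?_
  have hs := S.measurableSet_between (S.measurable_pickup n) (S.measurable_completion n)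
  exact measurable_measure_prodMk_left
    (hs.inter (measurable_snd (measurableSet_Icc (a := (0 : ℝ)) (b := T))))

lemma lintegral_tsum_trip_dispatch {h : ℝ≥0 → ℝ≥0∞} (hh : Measurable h) (T : ℝ≥0) :
    ∫⁻ ω, ∑' n, h (S.rides.trip n ω) *
      (Set.Iic (T : ℝ≥0∞)).indicator 1 (S.rides.dispatch n ω) ∂S.P =
    (∫⁻ y, h y ∂M.tripLaw) * (ENNReal.ofReal S.meanInService + T * S.throughput) := by
  have hk : Measurable fun z : ℝ≥0∞ × M.State × ℝ≥0∞ =>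
      (Set.Iic (T : ℝ≥0∞)).indicator (1 : ℝ≥0∞ → ℝ≥0∞) z.2.2 :=
    (measurable_one.indicator measurableSet_Iic).comp measurable_snd.snd
  rw [S.lintegral_tsum_trip hh hk, S.lintegral_tsum_dispatch, ofReal_meanInService, throughput]

/-- The time spent by the drivers in service is split into pick-up times and on-trip times. -/
lemma lintegral_pickup_add_tripTime (T : ℝ≥0) :
    (∫⁻ ω, (∫⁻ t in Set.Icc (0 : ℝ) T, (S.rides.numInPickup t.toNNReal ω : ℝ≥0∞)) ∂S.P) +
      ∫⁻ ω, S.tripTime T ω ∂S.P = T * ENNReal.ofReal S.meanInService := by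
  -- Additivity needs measurability of one summand only, so none has to be shown for the pick-up
  -- integral.
  rw [← lintegral_add_right _ (S.measurable_tripTime T)]
  trans ∫⁻ ω, (∫⁻ t in Set.Icc 0 (T : ℝ), (fun x : M.State => (x.1.val : ℝ≥0∞))
      (S.rides.stateAt M t.toNNReal ω)) ∂S.P
  · refine lintegral_congr_ae ?_
    filter_upwards [S.tsum_between_eq_numInService, S.finite_dispatched, S.dispatch_le_pickup]
      with ω h1 hfin h2
    have hs : ∀ n, MeasurableSet {t : ℝ | S.rides.pickup n ω ≤ t.toNNReal ∧
        t.toNNReal < S.rides.pickup n ω + S.rides.trip n ω} := fun n =>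
      measurable_prodMk_left
        (S.measurableSet_between (S.measurable_pickup n) (S.measurable_completion n))
    have htrip : S.tripTime T ω = ∫⁻ t in Set.Icc 0 (T : ℝ), ∑' n,
        {t : ℝ | S.rides.pickup n ω ≤ t.toNNReal ∧
          t.toNNReal < S.rides.pickup n ω + S.rides.trip n ω}.indicator 1 t := by
      rw [lintegral_tsum fun n => (measurable_one.indicator (hs n)).aemeasurable]
      refine tsum_congr fun n => ?_
      rw [lintegral_indicator_one (hs n), Measure.restrict_apply (hs n)]
    rw [htrip, ← lintegral_add_right _
      (Measurable.tsum fun n => measurable_one.indicator (hs n))]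
    refine lintegral_congr fun t => ?_
    rw [← h1, Rides.numInPickup, natCast_ncard_eq_tsum ((hfin _).subset fun n hn => hn.1),
      ← ENNReal.tsum_add]
    refine tsum_congr fun n => ?_
    have h3 := h2 n
    have h4 : S.rides.pickup n ω ≤ S.rides.completion n ω := le_self_add
    rw [← Rides.completion]
    simp only [Set.indicator_apply, Set.mem_ofPred_eq, Pi.one_apply]
    rcases lt_or_ge (t.toNNReal : ℝ≥0∞) (S.rides.pickup n ω) with h | h
    · simp [h, h.not_ge, h.trans_le h4]
    · simp [h, h.not_gt, h3.trans h]
  · rw [S.lintegral_lintegral_stateAt (Set.Icc 0 (T : ℝ)) fun x => (x.1.val : ℝ≥0∞),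
      ofReal_meanInService]
    simp

/-- Little's law for the riders on trip. -/
lemma tendsto_tripTime :
    Tendsto (fun T : ℝ => (∫⁻ ω, S.tripTime T.toNNReal ω ∂S.P).toReal / T) atTop
      (𝓝 (M.t0 * S.throughput.toReal)) := by
  have hA := S.throughput_ne_top
  have htail_le : ∀ K : ℕ, ∫⁻ y, (Set.Ioi (K : ℝ≥0)).indicator (fun y => (y : ℝ≥0∞)) y
      ∂M.tripLaw ≠ ∞ := fun K => by
    refine ne_top_of_le_ne_top (M.tripLaw_mean ▸ ENNReal.ofReal_ne_top)
      (lintegral_mono fun y => Set.indicator_le_self _ _ _)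
  -- The error e K of `tendsto_div_of_linear_bounds` is the mean on-trip time carried by trips
  -- longer than K; it vanishes because t₀ is finite.
  have htail := (ENNReal.tendsto_toReal ENNReal.zero_ne_top).comp
    (tendsto_lintegral_tail (M.tripLaw_mean ▸ ENNReal.ofReal_ne_top))
  rw [ENNReal.toReal_zero] at htail
  have hreal : ∀ T : ℝ, 0 < T →
      (ENNReal.ofReal S.meanInService + T.toNNReal * S.throughput).toReal =
        S.meanInService + T * S.throughput.toReal := fun T hT => by
    rw [ENNReal.toReal_add (by finiteness) (by finiteness), ENNReal.toReal_mul,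
      ENNReal.toReal_ofReal S.meanInService_nonneg, ENNReal.coe_toReal, Real.coe_toNNReal _ hT.le]
  have hup : ∀ T : ℝ≥0, ∫⁻ ω, S.tripTime T ω ∂S.P ≤
      ENNReal.ofReal M.t0 * (ENNReal.ofReal S.meanInService + T * S.throughput) := fun T => by
    rw [← M.tripLaw_mean, ← S.lintegral_tsum_trip_dispatch measurable_coe_nnreal_ennreal]
    exact lintegral_mono_ae (S.tripTime_le T)
  have hfin : ∀ T : ℝ≥0, ∫⁻ ω, S.tripTime T ω ∂S.P ≠ ∞ := fun T =>
    ne_top_of_le_ne_top (by finiteness) (hup T)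
  refine tendsto_div_of_linear_bounds (l := S.meanInService) htail (fun T hT => ?_)
    fun K T hT => ?_
  · rw [← hreal T hT, ← ENNReal.toReal_ofReal M.t0_pos.le, ← ENNReal.toReal_mul]
    exact ENNReal.toReal_mono (by finiteness) (hup _)
  · have hm : Measurable fun ω => (K : ℝ≥0∞) *
        ((S.rides.stateAt M T.toNNReal ω).1.val : ℝ≥0∞) :=
      (Measurable.of_discrete (f := fun x : M.State => (K : ℝ≥0∞) * (x.1.val : ℝ≥0∞))).comp
        (S.measurable_stateAt T.toNNReal)
    have hm' : Measurable fun ω => S.tripTime T.toNNReal ω +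
        K * ((S.rides.stateAt M T.toNNReal ω).1.val : ℝ≥0∞) := (S.measurable_tripTime _).add hm
    have h := lintegral_mono_ae (S.le_tripTime T.toNNReal K)
    rw [lintegral_add_left hm',
      lintegral_add_left (S.measurable_tripTime _),
      S.lintegral_tsum_trip_dispatch measurable_coe_nnreal_ennreal,
      S.lintegral_tsum_trip_dispatch (measurable_coe_nnreal_ennreal.indicator measurableSet_Ioi),
      S.lintegral_stateAt T.toNNReal fun x => (K : ℝ≥0∞) * (x.1.val : ℝ≥0∞),
      M.tripLaw_mean] at h
    have h1 : ∑' x, S.π x * ((K : ℝ≥0∞) * (x.1.val : ℝ≥0∞)) =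
        K * ENNReal.ofReal S.meanInService := by
      rw [ofReal_meanInService, ← ENNReal.tsum_mul_left]
      exact tsum_congr fun x => by ring
    rw [h1] at h
    have hfT := hfin T.toNNReal
    have htK := htail_le K
    have h2 := ENNReal.toReal_mono (by finiteness) h
    rw [ENNReal.toReal_add (by finiteness) (by finiteness),
      ENNReal.toReal_add (by finiteness) (by finiteness), ENNReal.toReal_mul, ENNReal.toReal_mul,
      ENNReal.toReal_mul, hreal T hT, ENNReal.toReal_ofReal M.t0_pos.le,
      ENNReal.toReal_ofReal S.meanInService_nonneg, ENNReal.toReal_natCast] at h2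
    exact h2

lemma tendsto_averageInPickup :
    Tendsto S.averageInPickup atTop (𝓝 (S.meanInService - M.t0 * S.throughput.toReal)) := by
  refine (tendsto_const_nhds.sub S.tendsto_tripTime).congr' ?_
  filter_upwards [eventually_gt_atTop 0] with T hT
  have h := S.lintegral_pickup_add_tripTime T.toNNReal
  have hfin : (T.toNNReal : ℝ≥0∞) * ENNReal.ofReal S.meanInService ≠ ∞ := by finiteness
  -- Finiteness of the total service time makes both parts finite, so the identity passes to the
  -- reals and can be subtracted.
  rw [← h, ENNReal.add_ne_top] at hfin
  have h2 := congrArg ENNReal.toReal h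
  rw [ENNReal.toReal_add hfin.1 hfin.2, ENNReal.toReal_mul, ENNReal.coe_toReal,
    ENNReal.toReal_ofReal S.meanInService_nonneg, Real.coe_toNNReal _ hT.le] at h2
  rw [averageInPickup, eq_sub_of_add_eq h2, sub_div, mul_div_cancel_left₀ _ hT.ne']

lemma meanInPickup_eq : S.meanInPickup = S.meanInService - M.t0 * S.throughput.toReal :=
  S.tendsto_averageInPickup.limUnder_eq

/-- The two objectives differ by a constant that does not depend on the policy. -/
lemma reducedObjective_eq {p0 wp : ℝ} (hp0 : 0 ≤ p0) (hwp : 0 ≤ wp) (ws wo wq : ℝ) :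
    S.reducedObjective (p0 + wp * M.t0) (ws + wp - wo) wq =
      S.objective p0 ws wo wp wq + ((wo * M.L : ℝ) : EReal) := by
  have hp0' : 0 ≤ p0 + wp * M.t0 := add_nonneg hp0 (mul_nonneg hwp M.t0_pos.le)
  -- The queueing term is the same on both sides and is only moved aside, so it may be infinite.
  rw [reducedObjective, objective, S.revenueRate_eq hp0, S.revenueRate_eq hp0', meanInPickup_eq,
    meanIdle_eq, sub_eq_add_neg (_ : EReal), sub_eq_add_neg (_ : EReal), add_right_comm,
    ← EReal.coe_add]
  congr 2
  ring

end SteadyState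

/-- A real constant cancels in `EReal` inequalities even at −∞, so policies with an infinite mean
queue need no separate treatment. -/
lemma argmax_add_coe {α : Type*} (f : α → EReal) (c : ℝ) :
    argmax (fun a => f a + (c : EReal)) = argmax f := by
  ext a
  exact forall_congr' fun b => (EReal.addLECancellable_coe c).add_le_add_iff_right

end RideHailing

theorem lemma1 (M : RideHailing.Model)
    (S : ∀ p : M.StablePolicy, RideHailing.SteadyState M p.1)
    (p0 ws wo wp wq : ℝ) (hp0 : 0 ≤ p0) (hws : 0 < ws) (hwo : 0 < wo) (hwp : 0 < wp)
    (hwq : 0 < wq) :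
    (∀ p : M.StablePolicy,
      (∃ r, Tendsto (fun T : ℝ => (S p).expectedRevenue p0 T / T) atTop (𝓝 r)) ∧
      (∃ r, Tendsto (fun T : ℝ => (S p).expectedRevenue (p0 + wp * M.t0) T / T) atTop (𝓝 r)) ∧
      (∃ r, Tendsto (S p).averageInPickup atTop (𝓝 r))) ∧
    RideHailing.argmax (fun p => (S p).objective p0 ws wo wp wq) =
      RideHailing.argmax
        (fun p => (S p).reducedObjective (p0 + wp * M.t0) (ws + wp - wo) wq) := by
  refine ⟨fun p => ⟨⟨_, (S p).tendsto_revenueRate hp0⟩, ⟨_, (S p).tendsto_revenueRate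
    (add_nonneg hp0 (mul_nonneg hwp.le M.t0_pos.le))⟩, ⟨_, (S p).tendsto_averageInPickup⟩⟩, ?_⟩
  simp only [fun p => (S p).reducedObjective_eq hp0 hwp.le ws wo wq]
  rw [RideHailing.argmax_add_coe]
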